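/- Let $A$ be an associative ring with unit. Let $\mathrm{proj}(A)$ and $\mathrm{mod}\text{-}A$ be the categories of finitely generated projective and of finitely presented left $A$-modules, and $\mathrm{proj}(A^{op})$, $\mathrm{mod}\text{-}A^{op}$ those of right $A$-modules. Let $\mathrm{mod}\text{-}(\mathrm{mod}\text{-}A)$ be the category of additive functors $F:\mathrm{mod}\text{-}A\to\mathrm{Ab}$ that admit an exact sequence $\mathrm{Hom}(N,-)\to\mathrm{Hom}(M,-)\to F\to 0$ with $M,N\in\mathrm{mod}\text{-}A$. For an additive category $\mathcal X$ let $\mathrm{III}(\mathcal X)$ be Adelman's category: its objects are diagrams $X_1\xrightarrow{f_1}X_2\xrightarrow{f_2}X_3$ in $\mathcal X$ (not necessarily complexes), and its morphisms from $X$ to $Y=(Y_1\xrightarrow{g_1}Y_2\xrightarrow{g_2}Y_3)$ are commutative diagrams $(\alpha_1,\alpha_2,\alpha_3)$ modulo those for which $\alpha_2=g_1s+tf_2$ for some $s:X_2\to Y_1$, $t:X_3\to Y_2$. Put $\mathfrak j(X)=(0\to X\to 0)$. As usual for functors between abelian categories (all categories $\mathrm{III}(-)$ and $\mathrm{mod}\text{-}(\mathrm{mod}\text{-}-)$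 here are known to be abelian), exact means preserving finite limits and finite colimits. For $P\in \mathrm{proj}(A)$, $P^*=\mathrm{Hom}_A(P,A)\in \mathrm{proj}(A^{op})$. (1) Applying $\mathrm{Hom}_A(-,A)$ termwise, $(P\to Q\to R)\mapsto(R^*\to Q^*\to P^*)$, gives a duality (contravariant equivalence) $(\ )^*:\mathrm{III}(\mathrm{proj}(A))\to\mathrm{III}(\mathrm{proj}(A^{op}))$. (2) There is, up to natural isomorphism, exactly one exact contravariant functor $\Phi_A:\mathrm{III}(\mathrm{proj}(A))\to\mathrm{mod}\text{-}(\mathrm{mod}\text{-}A)$ with $\Phi_A(\mathfrak j(P))\cong\mathrm{Hom}_A(P,-)$ naturally in $P\in\mathrm{proj}(A)$, and it is a (contravariant) equivalence, the canonical one. Likewise there is a canonical $\Phi_{A^{op}}:\mathrm{III}(\mathrm{proj}(A^{op}))\to\mathrm{mod}\text{-}(\mathrm{mod}\text{-}A^{op})$. (3) There is, up to natural isomorphism, exactly one exact contravariant functor $d:\mathrm{mod}\text{-}(\mathrm{mod}\text{-}A)\to\mathrm{mod}\text{-}(\mathrm{mod}\text{-}A^{op})$ with $d(\mathrm{Hom}(P,-))\cong\mathrm{Hom}(P^*,-)$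 naturally in $P\in\mathrm{proj}(A)$, and it is a duality, the Auslander–Gruson–Jensen duality. (4) Through the canonical equivalences, $(\ )^*$ corresponds to the Auslander–Gruson–Jensen duality: $\Phi_{A^{op}}\circ(\ )^*\cong d\circ\Phi_A$. -/

import Mathlib

open CategoryTheory CategoryTheory.Limits Opposite

universe v u w

namespace FreeAbelian

/-! ### The category of three-term diagrams modulo homotopy -/

section Adelman

/-- A diagram `X₁ ⟶ X₂ ⟶ X₃` in `C`; the composite is not required to vanish. -/
structure Chain3 (C : Type w) [Category.{v} C] where
  X₁ : C
  X₂ : C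
  X₃ : C
  f : X₁ ⟶ X₂
  g : X₂ ⟶ X₃

/-- A morphism of three-term diagrams: a commutative diagram. -/
@[ext]
structure Chain3.Hom {C : Type w} [Category.{v} C] (X Y : Chain3 C) where
  α₁ : X.X₁ ⟶ Y.X₁
  α₂ : X.X₂ ⟶ Y.X₂
  α₃ : X.X₃ ⟶ Y.X₃
  comm₁ : X.f ≫ α₂ = α₁ ≫ Y.f
  comm₂ : X.g ≫ α₃ = α₂ ≫ Y.g

instance (C : Type w) [Category.{v} C] : Category (Chain3 C) where
  Hom := Chain3.Hom
  id X := ⟨𝟙 _, 𝟙 _, 𝟙 _, by simp, by simp⟩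
  comp a b := ⟨a.α₁ ≫ b.α₁, a.α₂ ≫ b.α₂, a.α₃ ≫ b.α₃,
    by rw [← Category.assoc, a.comm₁, Category.assoc, b.comm₁, Category.assoc],
    by rw [← Category.assoc, a.comm₂, Category.assoc, b.comm₂, Category.assoc]⟩
  id_comp a := Chain3.Hom.ext (Category.id_comp _) (Category.id_comp _) (Category.id_comp _)
  comp_id a := Chain3.Hom.ext (Category.comp_id _) (Category.comp_id _) (Category.comp_id _)
  assoc a b c := Chain3.Hom.ext (Category.assoc _ _ _) (Category.assoc _ _ _)
    (Category.assoc _ _ _)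

variable (C : Type w) [Category.{v} C] [Preadditive C]

/-- Two morphisms `α, β : X ⟶ Y` are homotopic if their difference is null-homotopic:
`α₂ - β₂ = g₁ ∘ s + t ∘ f₂` for some `s : X₂ ⟶ Y₁` and `t : X₃ ⟶ Y₂`. -/
def homotopic : HomRel (Chain3 C) := fun X Y a b =>
  ∃ (s : X.X₂ ⟶ Y.X₁) (t : X.X₃ ⟶ Y.X₂), Chain3.Hom.α₂ a - Chain3.Hom.α₂ b = s ≫ Y.f + X.g ≫ t

instance : Congruence (homotopic C) where
  equivalence {X Y} :=
    { refl := fun a => ⟨0, 0, by simp⟩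
      symm := by
        rintro a b ⟨s, t, h⟩
        refine ⟨-s, -t, ?_⟩
        rw [← neg_sub, h, Preadditive.neg_comp, Preadditive.comp_neg, neg_add]
      trans := by
        rintro a b c ⟨s, t, h⟩ ⟨s', t', h'⟩
        refine ⟨s + s', t + t', ?_⟩
        rw [← sub_add_sub_cancel _ (Chain3.Hom.α₂ b), h, h', Preadditive.add_comp,
          Preadditive.comp_add]
        abel }
  comp_left {X Y Z} a {b b'} := by
    rintro ⟨s, t, h⟩
    refine ⟨a.α₂ ≫ s, a.α₃ ≫ t, ?_⟩
    change a.α₂ ≫ b.α₂ - a.α₂ ≫ b'.α₂ = _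
    rw [← Preadditive.comp_sub, h, Preadditive.comp_add, ← Category.assoc, ← Category.assoc,
      ← a.comm₂, Category.assoc, Category.assoc]
  comp_right {X Y Z} {a a'} b := by
    rintro ⟨s, t, h⟩
    refine ⟨s ≫ b.α₁, t ≫ b.α₂, ?_⟩
    change a.α₂ ≫ b.α₂ - a'.α₂ ≫ b.α₂ = _
    rw [← Preadditive.sub_comp, h, Preadditive.add_comp, Category.assoc, b.comm₁, Category.assoc,
      Category.assoc]

/-- Adelman's category `III(C)`: three-term diagrams in `C`, with commutative diagrams modulo
homotopy as morphisms. -/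
abbrev Adelman : Type (max w v) := CategoryTheory.Quotient (homotopic C)

open scoped ZeroObject in
/-- The canonical embedding `C ⥤ III(C)`, sending `X` to `0 ⟶ X ⟶ 0`. -/
noncomputable def Adelman.j [HasZeroObject C] : C ⥤ Adelman C :=
  { obj := fun X => { X₁ := 0, X₂ := X,
                      X₃ := 0, f := 0, g := 0 }
    map := fun a => ⟨0, a, 0, by simp, by simp⟩
    map_id := fun X => Chain3.Hom.ext ((isZero_zero C).eq_of_src _ _) rfl
      ((isZero_zero C).eq_of_src _ _)
    map_comp := fun a b => Chain3.Hom.ext ((isZero_zero C).eq_of_src _ _) rfl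
      ((isZero_zero C).eq_of_src _ _) : C ⥤ Chain3 C } ⋙ Quotient.functor (homotopic C)

variable {C} {D : Type*} [Category* D] [Preadditive D]

/-- A contravariant functor `T` from `C` to `D`, applied termwise to `X₁ ⟶ X₂ ⟶ X₃`, gives
`T X₃ ⟶ T X₂ ⟶ T X₁`. -/
abbrev Chain3.contra (T : Cᵒᵖ ⥤ D) (X : Chain3 C) : Chain3 D where
  X₁ := T.obj (op X.X₃)
  X₂ := T.obj (op X.X₂)
  X₃ := T.obj (op X.X₁)
  f := T.map X.g.op
  g := T.map X.f.op

/-- The action of `Chain3.contra` on morphisms. -/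
def Chain3.contraMap (T : Cᵒᵖ ⥤ D) {X Y : Chain3 C} (a : X ⟶ Y) :
    Chain3.contra T Y ⟶ Chain3.contra T X :=
  Chain3.Hom.mk (T.map (Chain3.Hom.α₃ a).op) (T.map (Chain3.Hom.α₂ a).op)
    (T.map (Chain3.Hom.α₁ a).op)
    (by simp only [← T.map_comp, ← op_comp, Chain3.Hom.comm₂ a])
    (by simp only [← T.map_comp, ← op_comp, Chain3.Hom.comm₁ a])

/-- A contravariant additive functor `T` from `C` to `D` induces, termwise, a contravariant functor
from `III(C)` to `III(D)`. -/
def Adelman.mapContra (T : Cᵒᵖ ⥤ D) [T.Additive] : (Adelman C)ᵒᵖ ⥤ Adelman D :=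
  (CategoryTheory.Quotient.lift (homotopic C)
    { obj := fun X => op ((Quotient.functor (homotopic D)).obj (X.contra T))
      map := fun a => ((Quotient.functor (homotopic D)).map (Chain3.contraMap T a)).op
      map_id := fun X => Quiver.Hom.unop_inj <|
        congrArg (Quotient.functor (homotopic D)).map <|
          Chain3.Hom.ext (T.map_id _) (T.map_id _) (T.map_id _)
      map_comp := fun a b => Quiver.Hom.unop_inj <|
        congrArg (Quotient.functor (homotopic D)).map <|
          Chain3.Hom.ext (T.map_comp (Chain3.Hom.α₃ b).op (Chain3.Hom.α₃ a).op)
            (T.map_comp (Chain3.Hom.α₂ b).op (Chain3.Hom.α₂ a).op)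
            (T.map_comp (Chain3.Hom.α₁ b).op (Chain3.Hom.α₁ a).op) }
    (by
      rintro X Y a b ⟨s, t, h⟩
      refine Quiver.Hom.unop_inj (CategoryTheory.Quotient.sound _ ⟨T.map t.op, T.map s.op, ?_⟩)
      change T.map (Chain3.Hom.α₂ a).op - T.map (Chain3.Hom.α₂ b).op = _
      rw [← T.map_sub, ← op_sub, h, op_add, T.map_add, op_comp, op_comp, T.map_comp, T.map_comp,
        add_comm])).leftOp

end Adelman

/-! ### Finitely presented functors -/

section FinitelyPresented

variable (C : Type w) [Category.{v} C] [Preadditive C]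

/-- The contravariant Yoneda embedding `X ↦ Hom(X, -)` into additive functors `C ⥤ Ab`. -/
def homFunctor : Cᵒᵖ ⥤ (C ⥤+ AddCommGrpCat.{v}) :=
  (additiveFunctor C AddCommGrpCat.{v}).lift preadditiveCoyoneda
    (fun X => (inferInstance : (preadditiveCoyoneda.obj X).Additive))

/-- An additive functor `F : C ⥤ Ab` is finitely presented if there is an exact sequence
`Hom(N, -) ⟶ Hom(M, -) ⟶ F ⟶ 0`. -/
def IsFinitelyPresented : ObjectProperty (C ⥤+ AddCommGrpCat.{v}) := fun F =>
  ∃ (M N : C) (φ : (homFunctor C).obj (op N) ⟶ (homFunctor C).obj (op M))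
    (π : (homFunctor C).obj (op M) ⟶ F), ∀ L : C,
      Function.Exact (φ.hom.app L) (π.hom.app L) ∧ Function.Surjective (π.hom.app L)

/-- `mod-C`: the category of finitely presented additive functors from `C` to abelian groups. -/
abbrev Mod : Type (max v w (v + 1)) := (IsFinitelyPresented C).FullSubcategory

lemma isFinitelyPresented_hom (X : Cᵒᵖ) : IsFinitelyPresented C ((homFunctor C).obj X) := by
  refine ⟨X.unop, X.unop, ⟨0⟩, 𝟙 _, fun L => ⟨fun y => ⟨fun h => ⟨0, ?_⟩, ?_⟩, fun y => ⟨y, rfl⟩⟩⟩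
  · have h' : y = 0 := h
    rw [h', map_zero]
  · rintro ⟨x, rfl⟩
    rfl

/-- The contravariant Yoneda embedding `X ↦ Hom(X, -)` of `C` into `mod-C`. -/
def Mod.yoneda : Cᵒᵖ ⥤ Mod C :=
  (IsFinitelyPresented C).lift (homFunctor C) (isFinitelyPresented_hom C)

end FinitelyPresented

/-! ### Modules over a ring; right `A`-modules are modules over `Aᵐᵒᵖ` -/

section Ring

variable (A : Type u) [Ring A]

/-- Finitely generated projective left `A`-modules, as a property. -/
def isFGProj : ObjectProperty (ModuleCat.{u} A) := fun P =>
  Module.Finite A P ∧ Module.Projective A P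

/-- Finitely presented left `A`-modules, as a property. -/
def isFP : ObjectProperty (ModuleCat.{u} A) := fun M => Module.FinitePresentation A M

/-- `proj(A)`: the category of finitely generated projective left `A`-modules. -/
abbrev Proj : Type (u + 1) := (isFGProj A).FullSubcategory

/-- `mod-A`: the category of finitely presented left `A`-modules. -/
abbrev FPMod : Type (u + 1) := (isFP A).FullSubcategory

/-- `mod-(mod-A)`: finitely presented additive functors from `mod-A` to abelian groups. -/
abbrev ModMod : Type (u + 1) := Mod (FPMod A)

instance : (isFGProj A).ContainsZero where
  exists_zero := ⟨ModuleCat.of A PUnit, ModuleCat.isZero_of_subsingleton _,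
    (inferInstance : Module.Finite A PUnit.{u + 1}),
    (inferInstance : Module.Projective A PUnit.{u + 1})⟩

lemma isFGProj_le_isFP : isFGProj A ≤ isFP A := fun P hP => by
  have := hP.1
  have := hP.2
  exact Module.finitePresentation_of_projective A P

/-- The contravariant functor `P ↦ Hom_A(P, -)` from `proj(A)` to `mod-(mod-A)`. -/
def projHom : (Proj A)ᵒᵖ ⥤ ModMod A :=
  (ObjectProperty.ιOfLE (isFGProj_le_isFP A)).op ⋙ Mod.yoneda (FPMod A)

/-- The dual `P* = Hom_A(P, A)` of a finitely generated projective left module `P` is a finitely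
generated projective right module, for the action `(φ a)(p) = φ(p) a`. -/
lemma isFGProj_dual (P : ModuleCat.{u} A) (hP : isFGProj A P) :
    isFGProj Aᵐᵒᵖ (ModuleCat.of Aᵐᵒᵖ (P →ₗ[A] A)) := by
  have := hP.1
  have := hP.2
  obtain ⟨n, π, hπ⟩ := Module.Finite.exists_fin' A P
  obtain ⟨s, hs⟩ := Module.projective_lifting_property π LinearMap.id hπ
  let i : (P →ₗ[A] A) →ₗ[Aᵐᵒᵖ] (Fin n → Aᵐᵒᵖ) :=
    { toFun := fun φ k => MulOpposite.op (φ (π (Pi.single k 1)))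
      map_add' := fun _ _ => rfl
      map_smul' := fun _ _ => rfl }
  let r : (Fin n → Aᵐᵒᵖ) →ₗ[Aᵐᵒᵖ] (P →ₗ[A] A) :=
    { toFun := fun v =>
        { toFun := fun p => ∑ k, s p k * (v k).unop
          map_add' := fun p q => by simp [add_mul, Finset.sum_add_distrib]
          map_smul' := fun a p => by simp [mul_assoc, Finset.mul_sum] }
      map_add' := fun v w => by
        ext p
        simp [mul_add, Finset.sum_add_distrib]
      map_smul' := fun a v => by
        ext p
        simp [Finset.sum_mul, mul_assoc] }
  have hri : r ∘ₗ i = LinearMap.id := by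
    ext φ p
    change ∑ k, s p k * φ (π (Pi.single k 1)) = φ p
    have h1 : π (s p) = p := LinearMap.congr_fun hs p
    have h2 : s p = ∑ k, s p k • (Pi.single k (1 : A) : Fin n → A) := pi_eq_sum_univ' (s p)
    conv_rhs => rw [← h1, h2, map_sum, map_sum]
    simp
  exact ⟨Module.Finite.of_surjective r fun φ => ⟨i φ, LinearMap.congr_fun hri φ⟩,
    Module.Projective.of_split i r hri⟩

/-- The duality `P ↦ P* = Hom_A(P, A)` from left to right finitely generated projective
modules. -/
def dual : (Proj A)ᵒᵖ ⥤ Proj Aᵐᵒᵖ where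
  obj P := ⟨ModuleCat.of Aᵐᵒᵖ (P.unop.obj →ₗ[A] A), isFGProj_dual A _ P.unop.property⟩
  map f := ObjectProperty.homMk (ModuleCat.ofHom
    { toFun := fun φ => φ ∘ₗ f.unop.hom.hom
      map_add' := fun _ _ => rfl
      map_smul' := fun _ _ => rfl })
  map_id _ := rfl
  map_comp _ _ := rfl

instance : (dual A).Additive where
  map_add {P Q f g} := by
    apply ObjectProperty.hom_ext
    apply ModuleCat.hom_ext
    apply LinearMap.ext
    intro (φ : P.unop.obj →ₗ[A] A)
    exact LinearMap.ext fun p => map_add φ _ _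

/-- The functor `()* = Hom(-, A)` from `III(proj(A))` to `III(proj(Aᵒᵖ))`. -/
def dualIII : (Adelman (Proj A))ᵒᵖ ⥤ Adelman (Proj Aᵐᵒᵖ) := Adelman.mapContra (dual A)

variable {A}

/-- `Φ` is a canonical functor from `III(proj(A))` to `mod-(mod-A)`: it is contravariant, exact,
and extends `P ↦ Hom_A(P, -)` along the embedding `P ↦ (0 ⟶ P ⟶ 0)`. -/
structure IsCanonical (Φ : (Adelman (Proj A))ᵒᵖ ⥤ ModMod A) : Prop where
  leftExact : PreservesFiniteLimits Φ
  rightExact : PreservesFiniteColimits Φ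
  extendsHom : Nonempty ((Adelman.j (Proj A)).op ⋙ Φ ≅ projHom A)

/-- `d` is an Auslander-Gruson-Jensen duality: an exact contravariant functor from `mod-(mod-A)`
to `mod-(mod-Aᵒᵖ)` which takes `Hom(P, -)` to `Hom(P*, -)`, naturally in the finitely generated
projective left module `P`. -/
structure IsAGJ (d : (ModMod A)ᵒᵖ ⥤ ModMod Aᵐᵒᵖ) : Prop where
  leftExact : PreservesFiniteLimits d
  rightExact : PreservesFiniteColimits d
  onProj : Nonempty ((projHom A).rightOp ⋙ d ≅ (dual A).rightOp ⋙ projHom Aᵐᵒᵖ)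

end Ring

end FreeAbelian

open FreeAbelian

namespace FreeAbelian

/-! ### Functors determined by their values on projective objects -/

section Presentation

variable {P C D : Type*} [Category* P] [Category* C] [Category* D]

/-- `X` has a presentation by objects of `P`: it is the coequalizer of a pair of morphisms between
objects in the image of `i : P ⥤ C`, and morphisms from such objects to `X` lift. -/
def IsPresentable (i : P ⥤ C) (X : C) : Prop :=
  ∃ (P₀ P₁ : P) (f g : i.obj P₁ ⟶ i.obj P₀) (π : i.obj P₀ ⟶ X) (w : f ≫ π = g ≫ π),
    Nonempty (IsColimit (Cofork.ofπ π w)) ∧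
      ∀ (Q : P) (h : i.obj Q ⟶ X), ∃ k : i.obj Q ⟶ i.obj P₀, k ≫ π = h

lemma exists_iso_of_coequalizer {X₁ X₀ X Y₁ Y₀ Y : D} {f g : X₁ ⟶ X₀} {π : X₀ ⟶ X}
    {w : f ≫ π = g ≫ π} (hX : IsColimit (Cofork.ofπ π w)) {f' g' : Y₁ ⟶ Y₀} {π' : Y₀ ⟶ Y}
    {w' : f' ≫ π' = g' ≫ π'} (hY : IsColimit (Cofork.ofπ π' w')) (e₁ : X₁ ≅ Y₁) (e₀ : X₀ ≅ Y₀)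
    (hf : f ≫ e₀.hom = e₁.hom ≫ f') (hg : g ≫ e₀.hom = e₁.hom ≫ g') :
    ∃ e : X ≅ Y, π ≫ e.hom = e₀.hom ≫ π' := by
  have hf' : f' ≫ e₀.inv = e₁.inv ≫ f := by
    rw [Iso.eq_inv_comp, ← Category.assoc, ← hf, Category.assoc, e₀.hom_inv_id, Category.comp_id]
  have hg' : g' ≫ e₀.inv = e₁.inv ≫ g := by
    rw [Iso.eq_inv_comp, ← Category.assoc, ← hg, Category.assoc, e₀.hom_inv_id, Category.comp_id]
  obtain ⟨a, ha⟩ := Cofork.IsColimit.desc' hX (e₀.hom ≫ π') (by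
    rw [← Category.assoc, ← Category.assoc, hf, hg, Category.assoc, Category.assoc, w'])
  obtain ⟨b, hb⟩ := Cofork.IsColimit.desc' hY (e₀.inv ≫ π) (by
    rw [← Category.assoc, ← Category.assoc, hf', hg', Category.assoc, Category.assoc, w])
  change π ≫ a = _ at ha
  change π' ≫ b = _ at hb
  refine ⟨⟨a, b, Cofork.IsColimit.hom_ext hX ?_, Cofork.IsColimit.hom_ext hY ?_⟩, ha⟩
  · change π ≫ a ≫ b = π ≫ 𝟙 X
    rw [← Category.assoc, ha, Category.assoc, hb, Iso.hom_inv_id_assoc, Category.comp_id]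
  · change π' ≫ b ≫ a = π' ≫ 𝟙 Y
    rw [← Category.assoc, hb, Category.assoc, ha, Iso.inv_hom_id_assoc, Category.comp_id]

/-- Functors preserving coequalizers are determined by their restriction to a full subcategory
which presents every object. -/
theorem nonempty_iso_of_isPresentable (i : P ⥤ C) [i.Full] (hi : ∀ X, IsPresentable i X)
    (F G : C ⥤ D) [PreservesColimitsOfShape WalkingParallelPair F]
    [PreservesColimitsOfShape WalkingParallelPair G] (α : i ⋙ F ≅ i ⋙ G) :
    Nonempty (F ≅ G) := by
  choose P₀ P₁ f g π w hπ lift using hi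
  have hα : ∀ {Q Q' : P} (h : i.obj Q ⟶ i.obj Q'),
      F.map h ≫ α.hom.app Q' = α.hom.app Q ≫ G.map h := fun {Q Q'} h => by
    obtain ⟨h, rfl⟩ := i.map_surjective h
    exact α.hom.naturality h
  have hF := fun X => isColimitCoforkMapOfIsColimit F (w X) (hπ X).some
  have hG := fun X => isColimitCoforkMapOfIsColimit G (w X) (hπ X).some
  choose θ hθ using fun X => exists_iso_of_coequalizer (hF X) (hG X) (α.app (P₁ X)) (α.app (P₀ X))
    (hα _) (hα _)
  refine ⟨NatIso.ofComponents θ fun {X Y} h => Cofork.IsColimit.hom_ext (hF X) ?_⟩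
  change F.map (π X) ≫ F.map h ≫ (θ Y).hom = F.map (π X) ≫ (θ X).hom ≫ G.map h
  obtain ⟨k, hk⟩ := lift Y _ (π X ≫ h)
  rw [← Category.assoc, ← F.map_comp, ← hk, F.map_comp, Category.assoc, hθ, ← Category.assoc,
    Iso.app_hom, hα, Category.assoc, ← G.map_comp, hk, G.map_comp, ← Category.assoc,
    ← Iso.app_hom, ← hθ, Category.assoc]

end Presentation

/-! ### Duality between Adelman categories -/

section MapContra

variable {C D : Type*} [Category* C] [Category* D] [Preadditive C] [Preadditive D]

/-- An isomorphism of three-term diagrams from termwise isomorphisms. -/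
def Chain3.isoMk {X Y : Chain3 C} (e₁ : X.X₁ ≅ Y.X₁) (e₂ : X.X₂ ≅ Y.X₂) (e₃ : X.X₃ ≅ Y.X₃)
    (h₁ : X.f ≫ e₂.hom = e₁.hom ≫ Y.f) (h₂ : X.g ≫ e₃.hom = e₂.hom ≫ Y.g) : X ≅ Y where
  hom := Chain3.Hom.mk e₁.hom e₂.hom e₃.hom h₁ h₂
  inv := Chain3.Hom.mk e₁.inv e₂.inv e₃.inv
    (by rw [Iso.eq_inv_comp, ← Category.assoc, ← h₁, Category.assoc, Iso.hom_inv_id,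
      Category.comp_id])
    (by rw [Iso.eq_inv_comp, ← Category.assoc, ← h₂, Category.assoc, Iso.hom_inv_id,
      Category.comp_id])
  hom_inv_id := Chain3.Hom.ext e₁.hom_inv_id e₂.hom_inv_id e₃.hom_inv_id
  inv_hom_id := Chain3.Hom.ext e₁.inv_hom_id e₂.inv_hom_id e₃.inv_hom_id

lemma Adelman.functor_map_eq_iff {X Y : Chain3 C} (a b : X ⟶ Y) :
    (Quotient.functor (homotopic C)).map a = (Quotient.functor (homotopic C)).map b ↔
      homotopic C a b :=
  Quotient.functor_map_eq_iff (homotopic C) a b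

variable (T : Cᵒᵖ ⥤ D) [T.Additive]

instance [T.Full] [T.Faithful] : (Adelman.mapContra T).Full where
  map_surjective {X Y} k := by
    obtain ⟨a, rfl⟩ := (Quotient.functor (homotopic D)).map_surjective
      (X := X.unop.as.contra T) (Y := Y.unop.as.contra T) k
    let b : Y.unop.as ⟶ X.unop.as := Chain3.Hom.mk (T.preimage a.α₃).unop (T.preimage a.α₂).unop
      (T.preimage a.α₁).unop
      (Quiver.Hom.op_inj <| T.map_injective <| by simpa using a.comm₂.symm)
      (Quiver.Hom.op_inj <| T.map_injective <| by simpa using a.comm₁.symm)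
    refine ⟨((Quotient.functor (homotopic C)).map b).op, ?_⟩
    refine congrArg (Quotient.functor (homotopic D)).map (?_ : Chain3.contraMap T b = a)
    exact Chain3.Hom.ext (T.map_preimage _) (T.map_preimage _) (T.map_preimage _)

instance [T.Full] [T.Faithful] : (Adelman.mapContra T).Faithful where
  map_injective {X Y} k l h := by
    obtain ⟨a, ha⟩ := (Quotient.functor (homotopic C)).map_surjective
      (X := Y.unop.as) (Y := X.unop.as) k.unop
    obtain ⟨b, hb⟩ := (Quotient.functor (homotopic C)).map_surjective
      (X := Y.unop.as) (Y := X.unop.as) l.unop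
    obtain rfl : ((Quotient.functor (homotopic C)).map a).op = k := Quiver.Hom.unop_inj ha
    obtain rfl : ((Quotient.functor (homotopic C)).map b).op = l := Quiver.Hom.unop_inj hb
    obtain ⟨s, t, hst⟩ := (Adelman.functor_map_eq_iff (Chain3.contraMap T a)
      (Chain3.contraMap T b)).1 h
    refine congrArg Quiver.Hom.op ((Adelman.functor_map_eq_iff a b).2
      ⟨(T.preimage t).unop, (T.preimage s).unop, Quiver.Hom.op_inj <| T.map_injective ?_⟩)
    change T.map a.α₂.op - T.map b.α₂.op = s ≫ T.map Y.unop.as.g.op + T.map X.unop.as.f.op ≫ t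
      at hst
    rw [op_sub, T.map_sub, hst, op_add, T.map_add, op_comp, op_comp, T.map_comp, T.map_comp,
      Quiver.Hom.op_unop, Quiver.Hom.op_unop, T.map_preimage, T.map_preimage, add_comm]

instance [T.Full] [T.EssSurj] : (Adelman.mapContra T).EssSurj where
  mem_essImage Y := by
    let X : Chain3 C :=
      { X₁ := (T.objPreimage Y.as.X₃).unop
        X₂ := (T.objPreimage Y.as.X₂).unop
        X₃ := (T.objPreimage Y.as.X₁).unop
        f := (T.preimage ((T.objObjPreimageIso _).hom ≫ Y.as.g ≫ (T.objObjPreimageIso _).inv)).unop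
        g := (T.preimage ((T.objObjPreimageIso _).hom ≫ Y.as.f ≫
          (T.objObjPreimageIso _).inv)).unop }
    exact ⟨op ⟨X⟩, ⟨(Quotient.functor (homotopic D)).mapIso
      (Chain3.isoMk (X := X.contra T) (Y := Y.as) (T.objObjPreimageIso _) (T.objObjPreimageIso _)
        (T.objObjPreimageIso _) (by simp [X]) (by simp [X]))⟩⟩

instance [T.IsEquivalence] : (Adelman.mapContra T).IsEquivalence where

open scoped ZeroObject in
/-- `Adelman.mapContra T` extends `T`. -/
noncomputable def Adelman.jCompMapContra [HasZeroObject C] [HasZeroObject D] :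
    (Adelman.j C).op ⋙ Adelman.mapContra T ≅ T ⋙ Adelman.j D := by
  refine NatIso.ofComponents (fun P => (Quotient.functor (homotopic D)).mapIso (Chain3.isoMk
      (X := Chain3.contra T { X₁ := 0, X₂ := P.unop, X₃ := 0, f := 0, g := 0 })
      (Y := { X₁ := 0, X₂ := T.obj P, X₃ := 0, f := 0, g := 0 })
      (IsZero.iso (T.map_isZero (isZero_zero C).op) (isZero_zero D)) (Iso.refl _)
      (IsZero.iso (T.map_isZero (isZero_zero C).op) (isZero_zero D))
      ((T.map_isZero (isZero_zero C).op).eq_of_src _ _) ((isZero_zero D).eq_of_tgt _ _)))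
    fun {P Q} a => ?_
  refine congrArg (Quotient.functor (homotopic D)).map ?_
  refine Chain3.Hom.ext ((isZero_zero D).eq_of_tgt _ _) ?_ ((isZero_zero D).eq_of_tgt _ _)
  exact (Category.comp_id _).trans (Category.id_comp _).symm

end MapContra

/-! ### Finitely presented functors as cokernels of representable ones -/

section Mod

variable {C : Type w} [Category.{v} C] [Preadditive C]

/-- The image in `Hom(M, L)` of precomposition with `u : M ⟶ N`. -/
def precompRange (u : Arrow C) (L : C) : AddSubgroup (u.left ⟶ L) :=
  (Preadditive.leftComp L u.hom).range

/-- The cokernel of `Hom(u, -) : Hom(N, -) ⟶ Hom(M, -)` for a morphism `u : M ⟶ N`. -/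
def coyonedaCokernel (u : Arrow C) : C ⥤+ AddCommGrpCat.{v} :=
  ⟨{ obj := fun L => AddCommGrpCat.of ((u.left ⟶ L) ⧸ precompRange u L)
     map := fun {L L'} k => AddCommGrpCat.ofHom (QuotientAddGroup.map _ _
       (Preadditive.rightComp u.left k) (by
         rintro _ ⟨y, rfl⟩
         exact ⟨y ≫ k, (Category.assoc _ _ _).symm⟩))
     map_id := fun L => by
       ext x
       exact congrArg (QuotientAddGroup.mk (s := precompRange u L)) (Category.comp_id x)
     map_comp := fun {L L' L''} k l => by
       ext x
       exact congrArg (QuotientAddGroup.mk (s := precompRange u L''))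
         (Category.assoc x k l).symm },
    ⟨fun {L L' k l} => by
      ext x
      exact congrArg (QuotientAddGroup.mk (s := precompRange u L'))
        (Preadditive.comp_add _ _ _ x k l)⟩⟩

/-- The projection `Hom(M, -) ⟶ coyonedaCokernel u`. -/
def coyonedaCokernelπ (u : Arrow C) : (homFunctor C).obj (op u.left) ⟶ coyonedaCokernel u :=
  ⟨{ app := fun L => AddCommGrpCat.ofHom (QuotientAddGroup.mk' (precompRange u L))
     naturality := fun _ _ _ => rfl }⟩

lemma isFinitelyPresented_coyonedaCokernel (u : Arrow C) :
    IsFinitelyPresented C (coyonedaCokernel u) :=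
  ⟨u.left, u.right, (homFunctor C).map u.hom.op, coyonedaCokernelπ u, fun _ =>
    ⟨fun x => QuotientAddGroup.eq_zero_iff (N := precompRange u _) x, QuotientAddGroup.mk_surjective⟩⟩

variable (C) in
/-- The functor sending `u : M ⟶ N` to the cokernel of `Hom(u, -)`. -/
def Mod.ofArrow : (Arrow C)ᵒᵖ ⥤ Mod C where
  obj u := ⟨coyonedaCokernel u.unop, isFinitelyPresented_coyonedaCokernel u.unop⟩
  map {u u'} a := ⟨⟨{
    app := fun L => AddCommGrpCat.ofHom (QuotientAddGroup.map _ _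
      (Preadditive.leftComp L a.unop.left) (by
        rintro _ ⟨y, rfl⟩
        exact ⟨a.unop.right ≫ y, by
          change u'.unop.hom ≫ a.unop.right ≫ y = a.unop.left ≫ u.unop.hom ≫ y
          rw [← Category.assoc, ← Category.assoc, Arrow.w]⟩))
    naturality := fun L L' k => by
      ext x
      obtain ⟨x, rfl⟩ := QuotientAddGroup.mk_surjective x
      exact congrArg (QuotientAddGroup.mk (s := precompRange u'.unop L'))
        (Category.assoc _ _ _).symm }⟩⟩
  map_id u := by
    ext L x
    obtain ⟨x, rfl⟩ := QuotientAddGroup.mk_surjective x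
    exact congrArg (QuotientAddGroup.mk (s := precompRange u.unop L)) (Category.id_comp x)
  map_comp {u u' u''} a b := by
    ext L x
    obtain ⟨x, rfl⟩ := QuotientAddGroup.mk_surjective x
    exact congrArg (QuotientAddGroup.mk (s := precompRange u''.unop L)) (Category.assoc _ _ x)

lemma Mod.isIso_of_bijective {F G : Mod C} (a : F ⟶ G)
    (h : ∀ L, Function.Bijective (a.hom.hom.app L)) : IsIso a := by
  have : ∀ L, IsIso (a.hom.hom.app L) := fun L =>
    (ConcreteCategory.isIso_iff_bijective _).2 (h L)
  have : IsIso a.hom.hom := NatIso.isIso_of_isIso_app _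
  have : IsIso a.hom := (ObjectProperty.isIso_hom_iff _).1 this
  exact (ObjectProperty.isIso_hom_iff _).1 this

lemma Mod.hom_ext_app {F G : Mod C} {a b : F ⟶ G}
    (h : ∀ L (x : F.obj.obj.obj L), a.hom.hom.app L x = b.hom.hom.app L x) : a = b := by
  ext L x
  exact h L x

lemma Mod.congr_app {F G : Mod C} {a b : F ⟶ G} (h : a = b) (L : C) (x : F.obj.obj.obj L) :
    a.hom.hom.app L x = b.hom.hom.app L x := by rw [h]

lemma Mod.naturality_apply {F G : Mod C} (a : F ⟶ G) {L L' : C} (k : L ⟶ L')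
    (x : F.obj.obj.obj L) :
    a.hom.hom.app L' (F.obj.obj.map k x) = G.obj.obj.map k (a.hom.hom.app L x) :=
  ConcreteCategory.congr_hom (a.hom.hom.naturality k) x

lemma Mod.exists_desc {F G H : Mod C} (π : G ⟶ F) (a : G ⟶ H)
    (hπ : ∀ L, Function.Surjective (π.hom.hom.app L))
    (ha : ∀ L x, π.hom.hom.app L x = 0 → a.hom.hom.app L x = 0) : ∃ b : F ⟶ H, π ≫ b = a := by
  let b := fun L => AddMonoidHom.liftOfSurjective (π.hom.hom.app L).hom (hπ L)
    ⟨(a.hom.hom.app L).hom, fun x hx => ha L x hx⟩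
  have hb : ∀ L x, b L (π.hom.hom.app L x) = a.hom.hom.app L x := fun L x =>
    AddMonoidHom.liftOfRightInverse_comp_apply _ _ _ _ x
  refine ⟨⟨⟨{ app := fun L => AddCommGrpCat.ofHom (b L), naturality := fun L L' k => ?_ }⟩⟩,
    Mod.hom_ext_app fun L x => hb L x⟩
  ext y
  obtain ⟨x, rfl⟩ := hπ L y
  change b L' (F.obj.obj.map k (π.hom.hom.app L x)) = H.obj.obj.map k (b L (π.hom.hom.app L x))
  rw [← Mod.naturality_apply, hb, hb, Mod.naturality_apply]

/-- The morphism `Hom(M, -) ⟶ F` given by an element of `F M`. -/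
def Mod.homMk (F : Mod C) {M : C} (x : F.obj.obj.obj M) : (Mod.yoneda C).obj (op M) ⟶ F :=
  ⟨⟨{ app := fun L => AddCommGrpCat.ofHom
        { toFun := fun k => F.obj.obj.map k x
          map_zero' := ConcreteCategory.congr_hom (F.obj.obj.map_zero M L) x
          map_add' := fun k l => ConcreteCategory.congr_hom
            (F.obj.property.map_add (f := (k : M ⟶ L)) (g := l)) x }
      naturality := fun L L' k => by
        ext l
        exact ConcreteCategory.congr_hom (F.obj.obj.map_comp l k) x }⟩⟩

lemma Mod.yoneda_hom_apply {F : Mod C} {M L : C} (a : (Mod.yoneda C).obj (op M) ⟶ F)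
    (k : M ⟶ L) : a.hom.hom.app L k = F.obj.obj.map k (a.hom.hom.app M (𝟙 M)) := by
  refine Eq.trans ?_ (Mod.naturality_apply a k (𝟙 M))
  exact congrArg (a.hom.hom.app L) (Category.id_comp k).symm

lemma Mod.yoneda_hom_ext {F : Mod C} {M : C} {a b : (Mod.yoneda C).obj (op M) ⟶ F}
    (h : a.hom.hom.app M (𝟙 M) = b.hom.hom.app M (𝟙 M)) : a = b :=
  Mod.hom_ext_app fun L k => by
    rw [Mod.yoneda_hom_apply a k, Mod.yoneda_hom_apply b k, h]

instance : (Mod.yoneda C).Full where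
  map_surjective {X Y} a := ⟨(show Y.unop ⟶ X.unop from a.hom.hom.app X.unop (𝟙 X.unop)).op,
    Mod.yoneda_hom_ext (Category.comp_id _)⟩

/-- The projection `Hom(M, -) ⟶ Mod.ofArrow u`. -/
abbrev Mod.ofArrowπ (u : Arrow C) :
    (Mod.yoneda C).obj (op u.left) ⟶ (Mod.ofArrow C).obj (op u) :=
  ⟨coyonedaCokernelπ u⟩

lemma Mod.ofArrowπ_surjective (u : Arrow C) (L : C) :
    Function.Surjective ((Mod.ofArrowπ u).hom.hom.app L) :=
  QuotientAddGroup.mk_surjective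

lemma Mod.ofArrowπ_eq_iff (u : Arrow C) {L : C} (x y : u.left ⟶ L) :
    (Mod.ofArrowπ u).hom.hom.app L x = (Mod.ofArrowπ u).hom.hom.app L y ↔
      ∃ z : u.right ⟶ L, x - y = u.hom ≫ z := by
  refine (QuotientAddGroup.eq_iff_sub_mem (N := precompRange u L)).trans ?_
  exact exists_congr fun z => eq_comm

lemma Mod.ofArrowπ_naturality {u u' : Arrow C} (a : u ⟶ u') {L : C} (x : u'.left ⟶ L) :
    ((Mod.ofArrow C).map a.op).hom.hom.app L ((Mod.ofArrowπ u').hom.hom.app L x) =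
      (Mod.ofArrowπ u).hom.hom.app L (a.left ≫ x) := rfl

/-- Two morphisms of arrows induce the same morphism of cokernels if and only if their difference
on sources factors through `u`. -/
lemma Mod.ofArrow_map_eq_iff {u u' : Arrow C} (a b : u ⟶ u') :
    (Mod.ofArrow C).map a.op = (Mod.ofArrow C).map b.op ↔
      ∃ z : u.right ⟶ u'.left, a.left - b.left = u.hom ≫ z := by
  constructor
  · intro h
    rw [← Mod.ofArrowπ_eq_iff, ← Category.comp_id a.left, ← Category.comp_id b.left,
      ← Mod.ofArrowπ_naturality, ← Mod.ofArrowπ_naturality, h]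
  · rintro ⟨z, hz⟩
    refine Mod.hom_ext_app fun L x => ?_
    obtain ⟨x, rfl⟩ := Mod.ofArrowπ_surjective u' L x
    change u'.left ⟶ L at x
    rw [Mod.ofArrowπ_naturality, Mod.ofArrowπ_naturality, Mod.ofArrowπ_eq_iff]
    exact ⟨z ≫ x, by rw [← Preadditive.sub_comp, hz, Category.assoc]⟩

instance : (Mod.ofArrow C).Full where
  map_surjective {u' u} φ := by
    obtain ⟨a, ha⟩ := Mod.ofArrowπ_surjective u.unop _
      (φ.hom.hom.app _ ((Mod.ofArrowπ u'.unop).hom.hom.app _ (𝟙 _)))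
    change u.unop.left ⟶ u'.unop.left at a
    have key : ∀ (L : C) (x : u'.unop.left ⟶ L),
        φ.hom.hom.app L ((Mod.ofArrowπ u'.unop).hom.hom.app L x) =
          (Mod.ofArrowπ u.unop).hom.hom.app L (a ≫ x) := fun L x => by
      have h1 := Mod.yoneda_hom_apply (Mod.ofArrowπ u'.unop ≫ φ) x
      have h2 := Mod.naturality_apply (Mod.ofArrowπ u.unop) x a
      refine h1.trans (Eq.trans ?_ h2.symm)
      exact congrArg (((Mod.ofArrow C).obj u).obj.obj.map x) ha.symm
    obtain ⟨b, hb⟩ : ∃ b : u.unop.right ⟶ u'.unop.right, a ≫ u'.unop.hom = u.unop.hom ≫ b := by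
      have h0 : (Mod.ofArrowπ u'.unop).hom.hom.app _ u'.unop.hom =
          (Mod.ofArrowπ u'.unop).hom.hom.app _ (0 : u'.unop.left ⟶ _) :=
        (Mod.ofArrowπ_eq_iff _ _ _).2 ⟨𝟙 _, by rw [sub_zero, Category.comp_id]⟩
      have h1 := congrArg (φ.hom.hom.app _) h0
      rw [key, key, Mod.ofArrowπ_eq_iff] at h1
      simpa using h1
    refine ⟨(Arrow.homMk a b hb : u.unop ⟶ u'.unop).op, Mod.hom_ext_app fun L x => ?_⟩
    obtain ⟨x, rfl⟩ := Mod.ofArrowπ_surjective u'.unop L x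
    exact (key L x).symm

lemma Mod.exists_presentation (F : Mod C) :
    ∃ (u : Arrow C) (π : (Mod.yoneda C).obj (op u.left) ⟶ F),
      (∀ L, Function.Surjective (π.hom.hom.app L)) ∧
        ∀ (L : C) (x : u.left ⟶ L), π.hom.hom.app L x = 0 ↔ ∃ y : u.right ⟶ L, u.hom ≫ y = x := by
  obtain ⟨M, N, φ, π, h⟩ := F.property
  obtain ⟨k, hk⟩ := (Mod.yoneda C).map_surjective
    (⟨φ⟩ : (Mod.yoneda C).obj (op N) ⟶ (Mod.yoneda C).obj (op M))
  obtain rfl : ((Mod.yoneda C).map k).hom = φ := congrArg (fun a => a.hom) hk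
  exact ⟨Arrow.mk k.unop, ⟨π⟩, fun L => (h L).2, fun L => (h L).1⟩

instance : (Mod.ofArrow C).EssSurj where
  mem_essImage F := by
    obtain ⟨u, π, hs, hk⟩ := Mod.exists_presentation F
    obtain ⟨a, ha⟩ := Mod.exists_desc (Mod.ofArrowπ u) π (Mod.ofArrowπ_surjective u)
      fun L x hx => (hk L x).2 ((QuotientAddGroup.eq_zero_iff (N := precompRange u L) x).1 hx)
    replace ha : ∀ L (x : u.left ⟶ L),
        a.hom.hom.app L ((Mod.ofArrowπ u).hom.hom.app L x) = π.hom.hom.app L x := fun L x =>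
      Mod.congr_app ha L x
    have : IsIso a := Mod.isIso_of_bijective a fun L => by
      refine ⟨(injective_iff_map_eq_zero (a.hom.hom.app L).hom).2 fun x hx => ?_, fun y => ?_⟩
      · obtain ⟨x, rfl⟩ := Mod.ofArrowπ_surjective u L x
        exact (QuotientAddGroup.eq_zero_iff (N := precompRange u L) x).2
          ((hk L x).1 ((ha L x).symm.trans hx))
      · obtain ⟨x, rfl⟩ := hs L y
        exact ⟨(Mod.ofArrowπ u).hom.hom.app L x, ha L x⟩
    exact ⟨op u, ⟨asIso a⟩⟩

/-- Every finitely presented functor is presentable by representable functors. -/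
lemma Mod.isPresentable_yoneda (F : Mod C) : IsPresentable (Mod.yoneda C) F := by
  obtain ⟨u, π, hs, hk⟩ := Mod.exists_presentation F
  refine ⟨op u.left, op u.right, (Mod.yoneda C).map u.hom.op, (Mod.yoneda C).map 0, π,
    Mod.hom_ext_app fun L y => ?_, ⟨Cofork.IsColimit.mk' _ fun s => ?_⟩, fun Q a => ?_⟩
  · change u.right ⟶ L at y
    change π.hom.hom.app L (u.hom ≫ y) = π.hom.hom.app L ((0 : u.left ⟶ u.right) ≫ y)
    rw [(hk L _).2 ⟨y, rfl⟩, (hk L _).2 ⟨0, by rw [comp_zero, zero_comp]⟩]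
  · have hw : ∀ (L : C) (y : u.right ⟶ L),
        s.π.hom.hom.app L (u.hom ≫ y) = s.π.hom.hom.app L ((0 : u.left ⟶ u.right) ≫ y) :=
      fun L y => Mod.congr_app s.condition L y
    have hb : ∃ b, π ≫ b = s.π := Mod.exists_desc π s.π hs fun L x hx => by
      obtain ⟨y, rfl⟩ := (hk L x).1 hx
      refine (hw L y).trans ?_
      rw [zero_comp]
      exact map_zero (s.π.hom.hom.app L).hom
    refine ⟨hb.choose, hb.choose_spec, fun {m} hm => Mod.hom_ext_app fun L y => ?_⟩
    obtain ⟨x, rfl⟩ := hs L y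
    exact Mod.congr_app (hm.trans hb.choose_spec.symm) L x
  · obtain ⟨y, hy⟩ := hs _ (a.hom.hom.app _ (𝟙 Q.unop))
    exact ⟨Mod.homMk _ y, Mod.yoneda_hom_ext ((congrArg (π.hom.hom.app Q.unop)
      (Category.comp_id _)).trans hy)⟩

instance {J : Type} [SmallCategory J] : PreservesLimitsOfShape J (Mod.yoneda C) := by
  have (L : C) : PreservesLimitsOfShape J
      ((Mod.yoneda C ⋙ (IsFinitelyPresented C).ι ⋙ AdditiveFunctor.forget C AddCommGrpCat.{v}) ⋙
        (evaluation C AddCommGrpCat.{v}).obj L) := by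
    have := preservesSmallestLimits_of_preservesLimits (preadditiveYoneda.obj L)
    exact inferInstanceAs (PreservesLimitsOfShape J (preadditiveYoneda.obj L))
  have : PreservesLimitsOfShape J (Mod.yoneda C ⋙ (IsFinitelyPresented C).ι ⋙
      AdditiveFunctor.forget C AddCommGrpCat.{v}) :=
    preservesLimitsOfShape_of_evaluation _ _ this
  exact preservesLimitsOfShape_of_reflects_of_preserves _
    ((IsFinitelyPresented C).ι ⋙ AdditiveFunctor.forget C AddCommGrpCat.{v})

end Mod

/-! ### Presentations of finitely presented modules -/

section Presentations

variable (A : Type u) [Ring A]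

/-- The inclusion of finitely generated projective modules into finitely presented modules. -/
abbrev Proj.toFPMod : Proj A ⥤ FPMod A := ObjectProperty.ιOfLE (isFGProj_le_isFP A)

/-- The free module `A ^ n`. -/
abbrev Proj.free (n : ℕ) : Proj A :=
  ⟨ModuleCat.of A (Fin n → A), inferInstanceAs (Module.Finite A (Fin n → A)),
    inferInstanceAs (Module.Projective A (Fin n → A))⟩

variable {A}

lemma FPMod.hom_ext_apply {M N : FPMod A} {f g : M ⟶ N} (h : ∀ x, f.hom.hom x = g.hom.hom x) :
    f = g :=
  ObjectProperty.hom_ext _ (ModuleCat.hom_ext (LinearMap.ext h))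

lemma FPMod.congr_apply {M N : FPMod A} {f g : M ⟶ N} (h : f = g) (x : M.obj) :
    f.hom.hom x = g.hom.hom x := by rw [h]

lemma FPMod.hom_ext_of_surjective {L M N : FPMod A} {π : L ⟶ M}
    (hπ : Function.Surjective π.hom.hom) {f g : M ⟶ N} (h : π ≫ f = π ≫ g) : f = g := by
  refine FPMod.hom_ext_apply fun x => ?_
  obtain ⟨x, rfl⟩ := hπ x
  exact FPMod.congr_apply h x

lemma Proj.exists_lift {P : Proj A} {M N : FPMod A} {π : M ⟶ N}
    (hπ : Function.Surjective π.hom.hom) (h : (Proj.toFPMod A).obj P ⟶ N) :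
    ∃ k : (Proj.toFPMod A).obj P ⟶ M, k ≫ π = h := by
  have : Module.Projective A ((Proj.toFPMod A).obj P).obj := P.property.2
  obtain ⟨k, hk⟩ := Module.projective_lifting_property π.hom.hom h.hom.hom hπ
  exact ⟨ObjectProperty.homMk (ModuleCat.ofHom k),
    FPMod.hom_ext_apply fun x => LinearMap.congr_fun hk x⟩

lemma Proj.exists_hom_lift {P Q : Proj A} {N : FPMod A} {π : (Proj.toFPMod A).obj Q ⟶ N}
    (hπ : Function.Surjective π.hom.hom) (h : (Proj.toFPMod A).obj P ⟶ N) :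
    ∃ k : P ⟶ Q, (Proj.toFPMod A).map k ≫ π = h := by
  obtain ⟨k, hk⟩ := Proj.exists_lift hπ h
  obtain ⟨k, rfl⟩ := (Proj.toFPMod A).map_surjective k
  exact ⟨k, hk⟩

/-- `f` and `π` form an exact sequence `P ⟶ Q ⟶ M ⟶ 0`. -/
structure IsPresentation {P Q : Proj A} (f : P ⟶ Q) {M : FPMod A}
    (π : (Proj.toFPMod A).obj Q ⟶ M) : Prop where
  exact : Function.Exact f.hom.hom π.hom.hom
  surjective : Function.Surjective π.hom.hom

namespace IsPresentation

variable {P Q : Proj A} {f : P ⟶ Q} {M : FPMod A} {π : (Proj.toFPMod A).obj Q ⟶ M}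

lemma comp_eq_zero (h : IsPresentation f π) : (Proj.toFPMod A).map f ≫ π = 0 :=
  FPMod.hom_ext_apply fun x => (h.exact _).2 ⟨x, rfl⟩

lemma exists_lift (h : IsPresentation f π) {R : Proj A} (k : R ⟶ Q)
    (hk : (Proj.toFPMod A).map k ≫ π = 0) : ∃ l : R ⟶ P, l ≫ f = k := by
  have : Module.Projective A R.obj := R.property.2
  have hk' : ∀ x, k.hom.hom x ∈ LinearMap.range f.hom.hom := fun x =>
    (h.exact _).1 (FPMod.congr_apply hk x)
  obtain ⟨l, hl⟩ := Module.projective_lifting_property f.hom.hom.rangeRestrict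
    (k.hom.hom.codRestrict _ hk') f.hom.hom.surjective_rangeRestrict
  refine ⟨ObjectProperty.homMk (ModuleCat.ofHom l), ObjectProperty.hom_ext _ (ModuleCat.hom_ext
    (LinearMap.ext fun x => ?_))⟩
  exact congrArg Subtype.val (LinearMap.congr_fun hl x)

lemma exists_desc (h : IsPresentation f π) {N : FPMod A} (k : (Proj.toFPMod A).obj Q ⟶ N)
    (hk : (Proj.toFPMod A).map f ≫ k = 0) : ∃ l : M ⟶ N, π ≫ l = k := by
  have hker : LinearMap.ker π.hom.hom ≤ LinearMap.ker k.hom.hom := fun x hx => by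
    obtain ⟨y, rfl⟩ := (h.exact x).1 hx
    exact FPMod.congr_apply hk y
  refine ⟨ObjectProperty.homMk (ModuleCat.ofHom ((LinearMap.ker π.hom.hom).liftQ k.hom.hom hker ∘ₗ
    (π.hom.hom.quotKerEquivOfSurjective h.surjective).symm.toLinearMap)),
    FPMod.hom_ext_apply fun x => ?_⟩
  change (LinearMap.ker π.hom.hom).liftQ k.hom.hom hker
    ((π.hom.hom.quotKerEquivOfSurjective h.surjective).symm (π.hom.hom x)) = k.hom.hom x
  rw [(LinearEquiv.symm_apply_eq _).2 (show π.hom.hom x =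
    π.hom.hom.quotKerEquivOfSurjective h.surjective (Submodule.Quotient.mk x) from rfl)]
  rfl

lemma exists_iso (h : IsPresentation f π) {N : FPMod A} {ρ : (Proj.toFPMod A).obj Q ⟶ N}
    (h' : IsPresentation f ρ) : ∃ e : M ≅ N, π ≫ e.hom = ρ := by
  obtain ⟨a, ha⟩ := h.exists_desc ρ h'.comp_eq_zero
  obtain ⟨b, hb⟩ := h'.exists_desc π h.comp_eq_zero
  refine ⟨⟨a, b, FPMod.hom_ext_of_surjective h.surjective ?_,
    FPMod.hom_ext_of_surjective h'.surjective ?_⟩, ha⟩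
  · rw [← Category.assoc, ha, hb, Category.comp_id]
  · rw [← Category.assoc, hb, ha, Category.comp_id]

end IsPresentation

lemma FPMod.exists_surjective (M : FPMod A) :
    ∃ (n : ℕ) (π : (Proj.toFPMod A).obj (Proj.free A n) ⟶ M), Function.Surjective π.hom.hom := by
  have : Module.FinitePresentation A M.obj := M.property
  obtain ⟨n, π, hπ⟩ := Module.Finite.exists_fin' A M.obj
  exact ⟨n, ObjectProperty.homMk (ModuleCat.ofHom π), hπ⟩

lemma IsPresentation.exists_of_surjective {Q : Proj A} {M : FPMod A}
    {π : (Proj.toFPMod A).obj Q ⟶ M} (hπ : Function.Surjective π.hom.hom) :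
    ∃ (m : ℕ) (f : Proj.free A m ⟶ Q), IsPresentation f π := by
  have : Module.FinitePresentation A M.obj := M.property
  have : Module.Finite A ((Proj.toFPMod A).obj Q).obj := Q.property.1
  have hfg : (LinearMap.ker π.hom.hom).FG := Module.FinitePresentation.fg_ker π.hom.hom hπ
  have : Module.Finite A (LinearMap.ker π.hom.hom) := Module.Finite.of_fg hfg
  obtain ⟨m, f, hf⟩ := Module.Finite.exists_fin' A (LinearMap.ker π.hom.hom)
  refine ⟨m, ObjectProperty.homMk (ModuleCat.ofHom ((LinearMap.ker π.hom.hom).subtype ∘ₗ f)),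
    fun x => ⟨fun hx => ?_, ?_⟩, hπ⟩
  · obtain ⟨y, hy⟩ := hf ⟨x, hx⟩
    exact ⟨y, congrArg Subtype.val hy⟩
  · rintro ⟨y, rfl⟩
    exact (f y).2

/-- Every finitely presented module is presentable by finitely generated projective ones. -/
lemma FPMod.isPresentable (M : FPMod A) : IsPresentable (Proj.toFPMod A) M := by
  obtain ⟨n, π, hπ⟩ := M.exists_surjective
  obtain ⟨m, f, h⟩ := IsPresentation.exists_of_surjective hπ
  refine ⟨_, _, (Proj.toFPMod A).map f, 0, π, by rw [h.comp_eq_zero, zero_comp],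
    ⟨Cofork.IsColimit.mk' _ fun s => ?_⟩, fun Q a => Proj.exists_lift hπ a⟩
  have hs := h.exists_desc s.π (s.condition.trans zero_comp)
  exact ⟨hs.choose, hs.choose_spec, fun {l} hl =>
    FPMod.hom_ext_of_surjective hπ (hl.trans hs.choose_spec.symm)⟩

/-- The cokernel of a morphism of finitely generated projective modules. -/
def Proj.coker {P Q : Proj A} (f : P ⟶ Q) : FPMod A :=
  ⟨ModuleCat.of A (Q.obj ⧸ LinearMap.range f.hom.hom), by
    have := P.property.1
    have : Module.FinitePresentation A Q.obj := isFGProj_le_isFP A _ Q.property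
    refine Module.finitePresentation_of_surjective (LinearMap.range f.hom.hom).mkQ
      (Submodule.mkQ_surjective _) ?_
    rw [Submodule.ker_mkQ, LinearMap.range_eq_map]
    exact Module.Finite.fg_top.map f.hom.hom⟩

/-- The projection onto the cokernel. -/
def Proj.cokerπ {P Q : Proj A} (f : P ⟶ Q) : (Proj.toFPMod A).obj Q ⟶ Proj.coker f :=
  ObjectProperty.homMk (ModuleCat.ofHom (LinearMap.range f.hom.hom).mkQ)

lemma Proj.isPresentation_cokerπ {P Q : Proj A} (f : P ⟶ Q) :
    IsPresentation f (Proj.cokerπ f) :=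
  ⟨fun _ => Submodule.Quotient.mk_eq_zero _, Submodule.mkQ_surjective _⟩

lemma Proj.cokerπ_surjective {P Q : Proj A} (f : P ⟶ Q) :
    Function.Surjective (Proj.cokerπ f).hom.hom := (Proj.isPresentation_cokerπ f).surjective

/-- The morphism of cokernels induced by a commutative square. -/
def Proj.cokerMap {P Q P' Q' : Proj A} {f : P ⟶ Q} {f' : P' ⟶ Q'} (a : P ⟶ P') (b : Q ⟶ Q')
    (h : f ≫ b = a ≫ f') : Proj.coker f ⟶ Proj.coker f' :=
  ObjectProperty.homMk (ModuleCat.ofHom (Submodule.mapQ _ _ b.hom.hom (by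
    rintro _ ⟨x, rfl⟩
    exact ⟨a.hom.hom x, (LinearMap.congr_fun (congrArg (fun k => k.hom.hom) h) x).symm⟩)))

lemma Proj.cokerπ_cokerMap {P Q P' Q' : Proj A} {f : P ⟶ Q} {f' : P' ⟶ Q'} (a : P ⟶ P')
    (b : Q ⟶ Q') (h : f ≫ b = a ≫ f') :
    Proj.cokerπ f ≫ Proj.cokerMap a b h = (Proj.toFPMod A).map b ≫ Proj.cokerπ f' := rfl

end Presentations

/-! ### The canonical equivalence -/

section Canonical

variable (A : Type u) [Ring A]

variable {A} in
/-- The morphism from the cokernel of `X₁ ⟶ X₂` to the cokernel of the composite `X₁ ⟶ X₃`. -/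
def Chain3.cokerHom (X : Chain3 (Proj A)) : Proj.coker X.f ⟶ Proj.coker (X.f ≫ X.g) :=
  Proj.cokerMap (𝟙 _) X.g (Category.id_comp _).symm

variable {A} in
lemma Chain3.cokerπ_cokerHom (X : Chain3 (Proj A)) :
    Proj.cokerπ X.f ≫ X.cokerHom = (Proj.toFPMod A).map X.g ≫ Proj.cokerπ (X.f ≫ X.g) := rfl

/-- The functor sending `X₁ ⟶ X₂ ⟶ X₃` to the morphism from the cokernel of `X₁ ⟶ X₂` to the
cokernel of the composite `X₁ ⟶ X₃`. -/
def Chain3.cokerArrow : Chain3 (Proj A) ⥤ Arrow (FPMod A) where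
  obj X := Arrow.mk X.cokerHom
  map {X Y} a := Arrow.homMk (Proj.cokerMap a.α₁ a.α₂ a.comm₁)
    (Proj.cokerMap a.α₁ a.α₃ (by rw [Category.assoc, a.comm₂, ← Category.assoc, a.comm₁,
      Category.assoc]))
    (FPMod.hom_ext_of_surjective (Proj.cokerπ_surjective _) (by
      dsimp only [Arrow.mk_hom, Arrow.mk_left, Arrow.mk_right]
      rw [← Category.assoc, Proj.cokerπ_cokerMap, Category.assoc, Chain3.cokerπ_cokerHom,
        ← Category.assoc (Proj.cokerπ X.f), Chain3.cokerπ_cokerHom, Category.assoc,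
        Proj.cokerπ_cokerMap, ← Category.assoc, ← Category.assoc, ← Functor.map_comp,
        ← Functor.map_comp, a.comm₂]))
  map_id X := Arrow.hom_ext _ _
    (FPMod.hom_ext_of_surjective (Proj.cokerπ_surjective _) rfl)
    (FPMod.hom_ext_of_surjective (Proj.cokerπ_surjective _) rfl)
  map_comp a b := Arrow.hom_ext _ _
    (FPMod.hom_ext_of_surjective (Proj.cokerπ_surjective _) rfl)
    (FPMod.hom_ext_of_surjective (Proj.cokerπ_surjective _) rfl)

variable {A}

namespace Chain3

variable (X : Chain3 (Proj A))

/-- The projection from `X₂` to the cokernel of `X₁ ⟶ X₂`. -/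
def leftπ : (Proj.toFPMod A).obj X.X₂ ⟶ ((cokerArrow A).obj X).left := Proj.cokerπ X.f

/-- The projection from `X₃` to the cokernel of `X₁ ⟶ X₃`. -/
def rightπ : (Proj.toFPMod A).obj X.X₃ ⟶ ((cokerArrow A).obj X).right := Proj.cokerπ (X.f ≫ X.g)

lemma isPresentation_leftπ : IsPresentation X.f X.leftπ := Proj.isPresentation_cokerπ X.f

lemma isPresentation_rightπ : IsPresentation (X.f ≫ X.g) X.rightπ :=
  Proj.isPresentation_cokerπ (X.f ≫ X.g)

lemma leftπ_hom : X.leftπ ≫ ((cokerArrow A).obj X).hom = (Proj.toFPMod A).map X.g ≫ X.rightπ := rfl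

variable {X} {Y : Chain3 (Proj A)} (a : X ⟶ Y)

lemma leftπ_map : X.leftπ ≫ ((cokerArrow A).map a).left =
      (Proj.toFPMod A).map a.α₂ ≫ Y.leftπ := rfl

lemma rightπ_map : X.rightπ ≫ ((cokerArrow A).map a).right =
      (Proj.toFPMod A).map a.α₃ ≫ Y.rightπ := rfl

end Chain3

instance : (Proj.toFPMod A).Additive where

lemma Chain3.homotopic_iff {X Y : Chain3 (Proj A)} (a b : X ⟶ Y) :
    homotopic (Proj A) a b ↔
      ∃ z : ((Chain3.cokerArrow A).obj X).right ⟶ ((Chain3.cokerArrow A).obj Y).left,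
        ((Chain3.cokerArrow A).map a).left - ((Chain3.cokerArrow A).map b).left =
          ((Chain3.cokerArrow A).obj X).hom ≫ z := by
  have hY := Y.isPresentation_leftπ
  constructor
  · rintro ⟨s, t, h⟩
    have h0 : X.f ≫ X.g ≫ t = (a.α₁ - b.α₁ - X.f ≫ s) ≫ Y.f := by
      rw [← sub_eq_iff_eq_add'.2 h, Preadditive.comp_sub, Preadditive.comp_sub,
        a.comm₁, b.comm₁, Preadditive.sub_comp, Preadditive.sub_comp, Category.assoc]
    obtain ⟨z, hz⟩ := X.isPresentation_rightπ.exists_desc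
      ((Proj.toFPMod A).map t ≫ Y.leftπ) (by
        rw [← Category.assoc, ← Functor.map_comp, Category.assoc, h0, Functor.map_comp,
          Category.assoc, hY.comp_eq_zero, comp_zero])
    refine ⟨z, FPMod.hom_ext_of_surjective X.isPresentation_leftπ.surjective ?_⟩
    rw [Preadditive.comp_sub, Chain3.leftπ_map,
      Chain3.leftπ_map, ← Preadditive.sub_comp, ← Functor.map_sub, h,
      Functor.map_add, Functor.map_comp, Preadditive.add_comp, Category.assoc, hY.comp_eq_zero,
      comp_zero, zero_add, ← Category.assoc, Chain3.leftπ_hom, Category.assoc, hz,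
      Functor.map_comp, Category.assoc]
  · rintro ⟨z, hz⟩
    obtain ⟨t, ht⟩ := Proj.exists_hom_lift Y.isPresentation_leftπ.surjective
      (X.rightπ ≫ z)
    obtain ⟨s, hs⟩ := hY.exists_lift (a.α₂ - b.α₂ - X.g ≫ t) (by
      rw [Functor.map_sub, Functor.map_sub, Preadditive.sub_comp, Preadditive.sub_comp,
        ← Chain3.leftπ_map, ← Chain3.leftπ_map,
        ← Preadditive.comp_sub, hz, Functor.map_comp, Category.assoc, ht, ← Category.assoc,
        ← Category.assoc, Chain3.leftπ_hom, sub_self])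
    exact ⟨s, t, by rw [hs, sub_add_cancel]⟩

instance : (Chain3.cokerArrow A).Full where
  map_surjective {X Y} k := by
    have hY := Y.isPresentation_leftπ
    obtain ⟨b, hb⟩ := Proj.exists_hom_lift Y.isPresentation_leftπ.surjective
      (X.leftπ ≫ k.left)
    obtain ⟨c, hc⟩ := Proj.exists_hom_lift Y.isPresentation_rightπ.surjective
      (X.rightπ ≫ k.right)
    obtain ⟨a, ha⟩ := hY.exists_lift (X.f ≫ b) (by
      rw [Functor.map_comp, Category.assoc, hb, ← Category.assoc,
        X.isPresentation_leftπ.comp_eq_zero, zero_comp])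
    obtain ⟨s, hs⟩ := Y.isPresentation_rightπ.exists_lift (X.g ≫ c - b ≫ Y.g) (by
      rw [Functor.map_sub, Preadditive.sub_comp, Functor.map_comp, Functor.map_comp,
        Category.assoc, Category.assoc, hc, ← Chain3.leftπ_hom, ← Category.assoc,
        ← Category.assoc, hb, ← Chain3.leftπ_hom, Category.assoc, Category.assoc,
        Arrow.w, sub_self])
    refine ⟨Chain3.Hom.mk (a + X.f ≫ s) (b + s ≫ Y.f) c ?_ ?_, Arrow.hom_ext _ _
      (FPMod.hom_ext_of_surjective X.isPresentation_leftπ.surjective ?_)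
      (FPMod.hom_ext_of_surjective X.isPresentation_rightπ.surjective ?_)⟩
    · rw [Preadditive.comp_add, Preadditive.add_comp, ha, Category.assoc]
    · rw [Preadditive.add_comp, Category.assoc, hs, add_sub_cancel]
    · refine (Chain3.leftπ_map _).trans ?_
      dsimp only
      rw [Functor.map_add, Functor.map_comp, Preadditive.add_comp, Category.assoc,
        hY.comp_eq_zero, comp_zero, add_zero, hb]
    · exact (Chain3.rightπ_map _).trans hc

instance : (Chain3.cokerArrow A).EssSurj where
  mem_essImage v := by
    obtain ⟨n, p, hp⟩ := v.left.exists_surjective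
    obtain ⟨l, ρ, hρ⟩ := v.right.exists_surjective
    obtain ⟨m, q, hq⟩ := IsPresentation.exists_of_surjective hρ
    obtain ⟨w, hw⟩ := Proj.exists_hom_lift hρ (p ≫ v.hom)
    let X₂ : Proj A := ⟨ModuleCat.of A ((Fin n → A) × (Fin m → A)),
      inferInstanceAs (Module.Finite A ((Fin n → A) × (Fin m → A))),
      inferInstanceAs (Module.Projective A ((Fin n → A) × (Fin m → A)))⟩
    let π : (Proj.toFPMod A).obj X₂ ⟶ v.left := ObjectProperty.homMk (ModuleCat.ofHom
      (p.hom.hom ∘ₗ LinearMap.fst A (Fin n → A) (Fin m → A)))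
    have hπ : Function.Surjective π.hom.hom := fun x => by
      obtain ⟨y, rfl⟩ := hp x
      exact ⟨(y, 0), rfl⟩
    obtain ⟨k, f, hf⟩ := IsPresentation.exists_of_surjective hπ
    let g : X₂ ⟶ Proj.free A l := ObjectProperty.homMk (ModuleCat.ofHom
      (LinearMap.coprod w.hom.hom q.hom.hom))
    have hg : (Proj.toFPMod A).map g ≫ ρ = π ≫ v.hom := FPMod.hom_ext_apply fun x => by
      change ρ.hom.hom (w.hom.hom x.1 + q.hom.hom x.2) = v.hom.hom.hom (p.hom.hom x.1)
      rw [map_add, (hq.exact _).2 ⟨x.2, rfl⟩, add_zero]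
      exact FPMod.congr_apply hw x.1
    have hfg : IsPresentation (f ≫ g) ρ := by
      refine ⟨fun x => ⟨fun hx => ?_, ?_⟩, hρ⟩
      · obtain ⟨y, rfl⟩ := (hq.exact x).1 hx
        obtain ⟨z, hz⟩ := (hf.exact ((0, y) : (Fin n → A) × (Fin m → A))).1
          (map_zero p.hom.hom)
        refine ⟨z, (congrArg g.hom.hom hz).trans ?_⟩
        change w.hom.hom 0 + q.hom.hom y = q.hom.hom y
        rw [map_zero, zero_add]
      · rintro ⟨y, rfl⟩
        refine (FPMod.congr_apply hg (f.hom.hom y)).trans ?_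
        change v.hom.hom.hom (π.hom.hom (f.hom.hom y)) = 0
        rw [(hf.exact _).2 ⟨y, rfl⟩, map_zero]
    let X : Chain3 (Proj A) := { X₁ := _, X₂ := _, X₃ := _, f := f, g := g }
    obtain ⟨e, he⟩ := X.isPresentation_leftπ.exists_iso hf
    obtain ⟨e', he'⟩ := X.isPresentation_rightπ.exists_iso hfg
    refine ⟨X, ⟨Arrow.isoMk e e'
      (FPMod.hom_ext_of_surjective X.isPresentation_leftπ.surjective ?_)⟩⟩
    rw [← Category.assoc, he, ← hg, ← he', ← Category.assoc, ← Category.assoc, X.leftπ_hom]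

lemma isEquivalence_quotient_lift {C D : Type*} [Category* C] [Category* D] {r : HomRel C}
    (F : C ⥤ D) [F.Full] [F.EssSurj] (h : ∀ (X Y : C) (a b : X ⟶ Y), r a b → F.map a = F.map b)
    (h' : ∀ (X Y : C) (a b : X ⟶ Y), F.map a = F.map b → r a b) :
    (CategoryTheory.Quotient.lift r F h).IsEquivalence := by
  obtain rfl : r = F.homRel := by
    funext X Y a b
    exact propext ⟨h X Y a b, h' X Y a b⟩
  infer_instance

lemma Chain3.homotopic_iff_map_eq {X Y : Chain3 (Proj A)} (a b : X ⟶ Y) :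
    homotopic (Proj A) a b ↔
      ((Chain3.cokerArrow A).op ⋙ Mod.ofArrow (FPMod A)).rightOp.map a =
        ((Chain3.cokerArrow A).op ⋙ Mod.ofArrow (FPMod A)).rightOp.map b :=
  (Chain3.homotopic_iff a b).trans <| (Mod.ofArrow_map_eq_iff _ _).symm.trans
    (Quiver.Hom.op_inj.eq_iff (f := Quiver.Hom.op)).symm

variable (A)

/-- The canonical contravariant equivalence from `III(proj(A))` to `mod-(mod-A)`: it takes a diagram
to the cokernel of the representable functors defined by `Chain3.cokerArrow`. -/
def canonical : (Adelman (Proj A))ᵒᵖ ⥤ ModMod A :=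
  (CategoryTheory.Quotient.lift (homotopic (Proj A))
    ((Chain3.cokerArrow A).op ⋙ Mod.ofArrow (FPMod A)).rightOp
    fun _ _ a b => (Chain3.homotopic_iff_map_eq a b).1).leftOp

instance : (canonical A).IsEquivalence := by
  have := isEquivalence_quotient_lift (r := homotopic (Proj A))
    ((Chain3.cokerArrow A).op ⋙ Mod.ofArrow (FPMod A)).rightOp
    (fun _ _ a b => (Chain3.homotopic_iff_map_eq a b).1)
    fun _ _ a b => (Chain3.homotopic_iff_map_eq a b).2
  unfold canonical
  infer_instance

end Canonical

section CanonicalExtends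

variable {A : Type u} [Ring A]

lemma Chain3.isIso_leftπ (X : Chain3 (Proj A)) (hX : X.f = 0) : IsIso X.leftπ := by
  obtain ⟨k, hk⟩ := X.isPresentation_leftπ.exists_desc (𝟙 _) (by
    rw [hX, Functor.map_zero, zero_comp])
  refine ⟨k, hk, FPMod.hom_ext_of_surjective X.isPresentation_leftπ.surjective ?_⟩
  rw [← Category.assoc, hk, Category.id_comp, Category.comp_id]

open scoped ZeroObject in
/-- The diagram `0 ⟶ P ⟶ 0`. -/
noncomputable abbrev Chain3.single (P : Proj A) : Chain3 (Proj A) :=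
  { X₁ := 0, X₂ := P, X₃ := 0, f := 0, g := 0 }

instance (P : Proj A) : IsIso (Chain3.single P).leftπ := Chain3.isIso_leftπ _ rfl

/-- The comparison between `Hom(P, -)` and the value of `canonical A` at `0 ⟶ P ⟶ 0`. -/
noncomputable def canonicalSingle (P : Proj A) :
    (projHom A).obj (op P) ⟶ (Mod.ofArrow _).obj (op ((Chain3.cokerArrow A).obj (.single P))) :=
  (Mod.yoneda (FPMod A)).map (inv (Chain3.single P).leftπ).op ≫ Mod.ofArrowπ _

lemma canonicalSingle_apply (P : Proj A) {L : FPMod A} (h : (Proj.toFPMod A).obj P ⟶ L) :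
    (canonicalSingle P).hom.hom.app L h =
      (Mod.ofArrowπ _).hom.hom.app L (inv (Chain3.single P).leftπ ≫ h) := rfl

instance (P : Proj A) : IsIso (canonicalSingle P) := Mod.isIso_of_bijective _ fun L => by
  have hu : ((Chain3.cokerArrow A).obj (.single P)).hom = 0 :=
    FPMod.hom_ext_of_surjective (Chain3.single P).isPresentation_leftπ.surjective (by
      rw [Chain3.leftπ_hom, Functor.map_zero, zero_comp, comp_zero])
  refine ⟨fun h h' e => ?_, fun y => ?_⟩
  · change (Proj.toFPMod A).obj P ⟶ L at h h'
    rw [canonicalSingle_apply, canonicalSingle_apply, Mod.ofArrowπ_eq_iff] at e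
    obtain ⟨z, hz⟩ := e
    rw [hu, zero_comp, sub_eq_zero] at hz
    exact (cancel_epi _).1 hz
  · obtain ⟨x, rfl⟩ := Mod.ofArrowπ_surjective _ L y
    change ((Chain3.cokerArrow A).obj (.single P)).left ⟶ L at x
    refine ⟨(Chain3.single P).leftπ ≫ x, ?_⟩
    rw [canonicalSingle_apply, IsIso.inv_hom_id_assoc]

variable (A) in
/-- The canonical functor extends `P ↦ Hom(P, -)`. -/
noncomputable def projHomIsoCanonical : projHom A ≅ (Adelman.j (Proj A)).op ⋙ canonical A := by
  refine NatIso.ofComponents (fun P => (asIso (canonicalSingle P.unop) :)) fun {P Q} a =>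
    Mod.hom_ext_app fun L h => ?_
  change (Proj.toFPMod A).obj P.unop ⟶ L at h
  let b : Chain3.single Q.unop ⟶ Chain3.single P.unop :=
    Chain3.Hom.mk 0 a.unop 0 (by simp) (by simp)
  have hb : inv (Chain3.single Q.unop).leftπ ≫ (Proj.toFPMod A).map a.unop =
      ((Chain3.cokerArrow A).map b).left ≫ inv (Chain3.single P.unop).leftπ := by
    rw [IsIso.inv_comp_eq, ← Category.assoc, IsIso.eq_comp_inv, Chain3.leftπ_map]
  have hj : ((Adelman.j (Proj A)).op ⋙ canonical A).map a =
      (Mod.ofArrow _).map ((Chain3.cokerArrow A).map b).op := by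
    refine congrArg (fun c => (Mod.ofArrow _).map ((Chain3.cokerArrow A).map c).op)
      (Chain3.Hom.ext ?_ rfl ?_)
    · exact (isZero_zero (Proj A)).eq_of_src _ _
    · exact (isZero_zero (Proj A)).eq_of_src _ _
  rw [hj]
  change (canonicalSingle Q.unop).hom.hom.app L ((Proj.toFPMod A).map a.unop ≫ h) =
    ((Mod.ofArrow _).map ((Chain3.cokerArrow A).map b).op).hom.hom.app L
      ((canonicalSingle P.unop).hom.hom.app L h)
  rw [canonicalSingle_apply, canonicalSingle_apply, Mod.ofArrowπ_naturality, ← Category.assoc, hb,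
    Category.assoc]

end CanonicalExtends

/-! ### Duality of finitely generated projective modules -/

section Dual

lemma exists_dualBasis (R : Type*) [Ring R] (P : Type*) [AddCommGroup P] [Module R P]
    [Module.Finite R P] [Module.Projective R P] :
    ∃ (n : ℕ) (e : Fin n → P) (φ : Fin n → P →ₗ[R] R), ∀ p, ∑ k, φ k p • e k = p := by
  obtain ⟨n, π, hπ⟩ := Module.Finite.exists_fin' R P
  obtain ⟨s, hs⟩ := Module.projective_lifting_property π LinearMap.id hπ
  refine ⟨n, fun k => π (Pi.single k 1), fun k => LinearMap.proj k ∘ₗ s, fun p => ?_⟩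
  have h1 : π (s p) = p := LinearMap.congr_fun hs p
  conv_rhs => rw [← h1, pi_eq_sum_univ' (s p), map_sum]
  exact Finset.sum_congr rfl fun k _ => (map_smul π _ _).symm

lemma finite_projective_of_dualBasis {R : Type*} [Ring R] {P : Type*} [AddCommGroup P]
    [Module R P] {n : ℕ} (e : Fin n → P) (φ : Fin n → P →ₗ[R] R)
    (h : ∀ p, ∑ k, φ k p • e k = p) : Module.Finite R P ∧ Module.Projective R P := by
  have hri : Fintype.linearCombination R e ∘ₗ LinearMap.pi φ = LinearMap.id :=
    LinearMap.ext h
  exact ⟨Module.Finite.of_surjective (Fintype.linearCombination R e) fun p =>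
    ⟨_, LinearMap.congr_fun hri p⟩, Module.Projective.of_split _ _ hri⟩

variable {A : Type u} [Ring A]

instance : (dual A).Faithful where
  map_injective {P Q} f g h := by
    have := P.unop.property.1
    have := P.unop.property.2
    obtain ⟨n, e, φ, he⟩ := exists_dualBasis A P.unop.obj
    refine Quiver.Hom.unop_inj (ObjectProperty.hom_ext _ (ModuleCat.hom_ext
      (LinearMap.ext fun q => ?_)))
    rw [← he (f.unop.hom.hom q), ← he (g.unop.hom.hom q)]
    refine Finset.sum_congr rfl fun k _ => congrArg (· • e k) ?_
    have hk : ((dual A).map f).hom.hom (φ k) = ((dual A).map g).hom.hom (φ k) := by rw [h]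
    exact LinearMap.congr_fun hk q

instance : (dual A).Full where
  map_surjective {P Q} Θ := by
    have := P.unop.property.1
    have := P.unop.property.2
    obtain ⟨n, e, φ, he⟩ := exists_dualBasis A P.unop.obj
    let θ : (P.unop.obj →ₗ[A] A) →ₗ[Aᵐᵒᵖ] (Q.unop.obj →ₗ[A] A) := Θ.hom.hom
    let f : Q.unop.obj →ₗ[A] P.unop.obj := ∑ k, (θ (φ k)).smulRight (e k)
    refine ⟨(ObjectProperty.homMk (ModuleCat.ofHom f) : Q.unop ⟶ P.unop).op,
      ObjectProperty.hom_ext _ (ModuleCat.hom_ext (LinearMap.ext fun (ψ : P.unop.obj →ₗ[A] A) =>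
        ?_))⟩
    have hψ : ψ = ∑ k, MulOpposite.op (ψ (e k)) • φ k := by
      ext p
      conv_lhs => rw [← he p, map_sum]
      simp
    change ψ ∘ₗ f = θ ψ
    conv_rhs => rw [hψ, map_sum]
    ext q
    simp [f]

instance : (dual A).EssSurj where
  mem_essImage Q := by
    have := Q.property.1
    have := Q.property.2
    obtain ⟨n, e, φ, he⟩ := exists_dualBasis Aᵐᵒᵖ Q.obj
    let φ' : Fin n → Q.obj →ₗ[Aᵐᵒᵖ] A := fun k =>
      { toFun := fun q => (φ k q).unop
        map_add' := fun p q => by simp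
        map_smul' := fun a q => by simp }
    let ev : Q.obj →ₗ[Aᵐᵒᵖ] ((Q.obj →ₗ[Aᵐᵒᵖ] A) →ₗ[A] A) :=
      { toFun := fun q =>
          { toFun := fun ψ => ψ q
            map_add' := fun _ _ => rfl
            map_smul' := fun _ _ => rfl }
        map_add' := fun p q => LinearMap.ext fun ψ => map_add ψ p q
        map_smul' := fun a q => LinearMap.ext fun ψ => map_smul ψ a q }
    have he' : ∀ ψ : Q.obj →ₗ[Aᵐᵒᵖ] A, ∑ k, ev (e k) ψ • φ' k = ψ := fun ψ => by
      ext q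
      conv_rhs => rw [← he q, map_sum]
      simp only [map_smul, LinearMap.sum_apply]
      rfl
    have hev : Function.Bijective ev := by
      refine ⟨(injective_iff_map_eq_zero ev).2 fun q hq => ?_, fun ξ => ?_⟩
      · rw [← he q]
        refine Finset.sum_eq_zero fun k _ => ?_
        have hk : φ k q = 0 := MulOpposite.unop_injective (LinearMap.congr_fun hq (φ' k))
        rw [hk, zero_smul]
      · refine ⟨∑ k, MulOpposite.op (ξ (φ' k)) • e k, LinearMap.ext fun ψ => ?_⟩
        conv_rhs => rw [← he' ψ, map_sum]
        simp [LinearMap.sum_apply]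
    exact ⟨op ⟨ModuleCat.of A (Q.obj →ₗ[Aᵐᵒᵖ] A), finite_projective_of_dualBasis φ'
      (fun k => ev (e k)) he'⟩, ⟨ObjectProperty.isoMk _
        (LinearEquiv.ofBijective ev hev).symm.toModuleIso⟩⟩

instance : (dual A).IsEquivalence where

end Dual

/-! ### Exact functors on `mod-(mod-A)` -/

section Main

variable {A : Type u} [Ring A]

/-- A natural isomorphism of contravariant functors, seen in the opposite of the target. -/
def isoRightOp {C D : Type*} [Category* C] [Category* D] {F G : Cᵒᵖ ⥤ D} (α : F ≅ G) :
    G.rightOp ≅ F.rightOp :=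
  NatIso.ofComponents (fun X => (α.app (op X)).op) fun f =>
    Quiver.Hom.unop_inj (α.hom.naturality f.op).symm

/-- A natural isomorphism of contravariant functors from one in the opposite of the target. -/
def isoOfRightOp {C D : Type*} [Category* C] [Category* D] {F G : Cᵒᵖ ⥤ D}
    (α : F.rightOp ≅ G.rightOp) : G ≅ F :=
  NatIso.ofComponents (fun X => (α.app X.unop).unop) fun f =>
    Quiver.Hom.op_inj (α.hom.naturality f.unop).symm

lemma preservesFiniteLimits_of_isEquivalence {C D : Type*} [Category* C] [Category* D] (F : C ⥤ D)
    [F.IsEquivalence] : PreservesFiniteLimits F := ⟨fun _ _ _ => inferInstance⟩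

lemma preservesFiniteColimits_of_isEquivalence {C D : Type*} [Category* C] [Category* D]
    (F : C ⥤ D) [F.IsEquivalence] : PreservesFiniteColimits F := ⟨fun _ _ _ => inferInstance⟩

/-- Exact functors on `mod-(mod-A)` are determined by their values on the functors `Hom(P, -)` with
`P` finitely generated projective. -/
theorem nonempty_iso_of_projHom_iso {D : Type*} [Category* D] (F G : ModMod A ⥤ D)
    [PreservesFiniteLimits F] [PreservesFiniteColimits F] [PreservesFiniteLimits G]
    [PreservesFiniteColimits G] (α : projHom A ⋙ F ≅ projHom A ⋙ G) : Nonempty (F ≅ G) := by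
  have hF := preservesColimitsOfShape_rightOp WalkingParallelPair (Mod.yoneda (FPMod A) ⋙ F)
  have hG := preservesColimitsOfShape_rightOp WalkingParallelPair (Mod.yoneda (FPMod A) ⋙ G)
  let α' : Proj.toFPMod A ⋙ (Mod.yoneda (FPMod A) ⋙ F).rightOp ≅
      Proj.toFPMod A ⋙ (Mod.yoneda (FPMod A) ⋙ G).rightOp := isoRightOp α.symm
  obtain ⟨β⟩ := nonempty_iso_of_isPresentable (Proj.toFPMod A) FPMod.isPresentable _ _ α'
  exact nonempty_iso_of_isPresentable (Mod.yoneda (FPMod A)) Mod.isPresentable_yoneda F G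
    (isoOfRightOp β).symm

lemma isCanonical_canonical : IsCanonical (canonical A) :=
  ⟨preservesFiniteLimits_of_isEquivalence _, preservesFiniteColimits_of_isEquivalence _,
    ⟨(projHomIsoCanonical A).symm⟩⟩

lemma IsCanonical.nonempty_iso {Φ : (Adelman (Proj A))ᵒᵖ ⥤ ModMod A} (hΦ : IsCanonical Φ) :
    Nonempty (Φ ≅ canonical A) := by
  have := hΦ.leftExact
  have := hΦ.rightExact
  have := preservesFiniteLimits_of_isEquivalence (canonical A).inv
  have := preservesFiniteColimits_of_isEquivalence (canonical A).inv
  obtain ⟨α⟩ := hΦ.extendsHom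
  obtain ⟨β⟩ := nonempty_iso_of_projHom_iso ((canonical A).inv ⋙ Φ) (𝟭 (ModMod A))
    (Functor.isoWhiskerRight (projHomIsoCanonical A) _ ≪≫
      Functor.isoWhiskerLeft (Adelman.j (Proj A)).op
        (Functor.isoWhiskerRight (canonical A).asEquivalence.unitIso.symm Φ) ≪≫ α)
  exact ⟨Functor.isoWhiskerRight (canonical A).asEquivalence.unitIso Φ ≪≫
    Functor.isoWhiskerLeft (canonical A) β⟩

variable (A) in
/-- The Auslander-Gruson-Jensen duality. -/
noncomputable def auslanderGrusonJensen : (ModMod A)ᵒᵖ ⥤ ModMod Aᵐᵒᵖ :=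
  (canonical A).rightOp.inv ⋙ (dualIII A).rightOp ⋙ canonical Aᵐᵒᵖ

instance : (dualIII A).IsEquivalence :=
  inferInstanceAs (Adelman.mapContra (dual A)).IsEquivalence

instance : (auslanderGrusonJensen A).IsEquivalence := by
  unfold auslanderGrusonJensen
  infer_instance

variable (A) in
/-- The canonical functors take `()*` to the Auslander-Gruson-Jensen duality. -/
noncomputable def dualIIICompCanonical :
    (dualIII A).rightOp ⋙ canonical Aᵐᵒᵖ ≅ (canonical A).rightOp ⋙ auslanderGrusonJensen A :=
  Functor.isoWhiskerRight (canonical A).rightOp.asEquivalence.unitIso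
    ((dualIII A).rightOp ⋙ canonical Aᵐᵒᵖ)

variable (A) in
/-- The Auslander-Gruson-Jensen duality takes `Hom(P, -)` to `Hom(P*, -)`. -/
noncomputable def projHomCompAuslanderGrusonJensen :
    (projHom A).rightOp ⋙ auslanderGrusonJensen A ≅ (dual A).rightOp ⋙ projHom Aᵐᵒᵖ :=
  Functor.isoWhiskerRight (isoRightOp (projHomIsoCanonical A)).symm
      (auslanderGrusonJensen A) ≪≫
    Functor.isoWhiskerLeft (Adelman.j (Proj A)) (dualIIICompCanonical A).symm ≪≫
    Functor.isoWhiskerRight (isoRightOp (Adelman.jCompMapContra (dual A))).symm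
      (canonical Aᵐᵒᵖ) ≪≫
    Functor.isoWhiskerLeft (dual A).rightOp (projHomIsoCanonical Aᵐᵒᵖ).symm

lemma isAGJ_auslanderGrusonJensen : IsAGJ (auslanderGrusonJensen A) :=
  ⟨preservesFiniteLimits_of_isEquivalence _, preservesFiniteColimits_of_isEquivalence _,
    ⟨projHomCompAuslanderGrusonJensen A⟩⟩

lemma IsAGJ.nonempty_iso {d d' : (ModMod A)ᵒᵖ ⥤ ModMod Aᵐᵒᵖ} (hd : IsAGJ d) (hd' : IsAGJ d') :
    Nonempty (d ≅ d') := by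
  have := hd.leftExact
  have := hd.rightExact
  have := hd'.leftExact
  have := hd'.rightExact
  have := preservesFiniteLimits_rightOp d
  have := preservesFiniteColimits_rightOp d
  have := preservesFiniteLimits_rightOp d'
  have := preservesFiniteColimits_rightOp d'
  obtain ⟨α⟩ := hd.onProj
  obtain ⟨α'⟩ := hd'.onProj
  obtain ⟨β⟩ := nonempty_iso_of_projHom_iso d.rightOp d'.rightOp (NatIso.op (α' ≪≫ α.symm))
  exact ⟨isoOfRightOp β.symm⟩

end Main

end FreeAbelian

theorem mainTheorem7 (A : Type u) [Ring A] :
    (dualIII A).IsEquivalence ∧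
    ∃ (Φ : (Adelman (Proj A))ᵒᵖ ⥤ ModMod A)
      (Ψ : (Adelman (Proj Aᵐᵒᵖ))ᵒᵖ ⥤ ModMod Aᵐᵒᵖ)
      (d : (ModMod A)ᵒᵖ ⥤ ModMod Aᵐᵒᵖ),
      (IsCanonical Φ ∧ Φ.IsEquivalence ∧ ∀ Φ', IsCanonical Φ' → Nonempty (Φ' ≅ Φ)) ∧
      (IsCanonical Ψ ∧ Ψ.IsEquivalence ∧ ∀ Ψ', IsCanonical Ψ' → Nonempty (Ψ' ≅ Ψ)) ∧
      (IsAGJ d ∧ d.IsEquivalence ∧ ∀ d', IsAGJ d' → Nonempty (d' ≅ d)) ∧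
      Nonempty ((dualIII A).rightOp ⋙ Ψ ≅ Φ.rightOp ⋙ d) :=
  ⟨inferInstance, canonical A, canonical Aᵐᵒᵖ, auslanderGrusonJensen A,
    ⟨isCanonical_canonical, inferInstance, fun _ h => h.nonempty_iso⟩,
    ⟨isCanonical_canonical, inferInstance, fun _ h => h.nonempty_iso⟩,
    ⟨isAGJ_auslanderGrusonJensen, inferInstance, fun _ h =>
      h.nonempty_iso isAGJ_auslanderGrusonJensen⟩, ⟨dualIIICompCanonical A⟩⟩
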